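/- Call a real number $C_0$ an Alon–Dubiner constant if, for every prime $p$, every sequence of at least $C_0p$ elements of $\mathbb{F}_p^3$ contains a zero-sum subsequence of length exactly $p$. A vector in $\mathbb{Z}_p^2$ (where $\mathbb{Z}_p$ is the ring of $p$-adic integers) is called primitive if $p$ does not divide both of its entries. (1) There is an Alon–Dubiner constant $C_0$ such that $C_0 + 2 \le 9996$. (2) Let $C_0$ be any Alon–Dubiner constant and put $C = C_0 + 2$. Then for every prime $p$, every integer $n \ge Cp$ and all primitive vectors $v_1, \dots, v_n \in \mathbb{Z}_p^2$, there exist distinct indices $i_1, \dots, i_t$ with $1 \le t \le p$ such that both entries of $v_{i_1} + \cdots + v_{i_t}$ are divisible by $p$ but at least one of them is not divisible by $p^2$. In particular, the conclusion of (2) holds with $C = 9996$. -/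

import Mathlib

/-- A vector over the `p`-adic integers is primitive if `p` does not divide all its entries. -/
def IsPrimitiveVec (p : ℕ) [Fact p.Prime] {r : ℕ} (v : Fin r → ℤ_[p]) : Prop :=
  ∃ j, ¬ (p : ℤ_[p]) ∣ v j

/-- `C₀` is an Alon–Dubiner constant in dimension three: for every prime `p`, every sequence of at
least `C₀ * p` elements of `𝔽_p³` contains a zero-sum subsequence of length exactly `p`. -/
def IsAlonDubinerConstant (C₀ : ℝ) : Prop :=
  ∀ (p : ℕ) [Fact p.Prime] (n : ℕ), C₀ * (p : ℝ) ≤ (n : ℝ) →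
    ∀ w : Fin n → Fin 3 → ZMod p,
      ∃ I : Finset (Fin n), I.card = p ∧ ∑ i ∈ I, w i = 0

/-!
The theorem has two independent halves.

**The constant 9994.** Let `w` be a sequence of at least `9994 * p` vectors of `𝔽_p ^ 3`.

If some affine plane contains `4 * p` of them, the problem is two-dimensional, and
`exists_zeroSum_card_eq` (Rónyai's bound `4 * p - 2`) applies. It is proved by the polynomial
method: `∑ (-1) ^ #I * F I` over all subsets `I` of an `n`-element set vanishes when `F` is a
polynomial of degree less than `n` in the indicator vector of `I`. Taking for `F` a function which
detects zero sums shows that a nonempty zero-sum subset exists, and a further factor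
`(#I).choose p - 2` excludes those of size `2 * p`.

Otherwise the sequence is spread out, and pairs of vectors `w a, w b` can be chosen one after the
other so that the set `Y` of all sums with one vector from each pair grows quickly
(`ManySubsums`). Adding a pair enlarges `Y` by the number `exitCard Y (w b - w a)` of points of `Y`
which leave `Y` under translation by the difference. As long as `Y` has fewer than about
`(p / 20) ^ 3` elements, the Loomis–Whitney inequality provides a difference for which
`#Y ^ (1 / 3)` grows by `1 / 5` (`exists_add_pow_three_le_card_add_exitCard`). From then on, Fourier analysis
provides a difference for which `#Y` grows by a factor `1 + 117 / p`
(`exists_mul_card_le_mul_exitCard`). Fewer than `p / 2` pairs make `Y` larger than half of the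
space, so two such sets, from disjoint blocks with `p` pairs in total, contain opposite elements.

**Sums divisible by `p` but not by `p ^ 2`.** Write a `p`-adic integer as `x = r + p * q` with a
digit `0 ≤ r < p`. If at most `p` elements have `∑ q` divisible by `p`, then `∑ x` is congruent to
the integer `∑ r` modulo `p ^ 2`, and `0 ≤ ∑ r < p ^ 2`; so `p ^ 2` does not divide `∑ x` unless all
digits `r` vanish (`not_sq_dvd_sum_of_dvd_sum`). The condition on `∑ q` is one further linear
condition over `𝔽_p`. If at least `3 * p - 2` of the vectors have first entry divisible by `p`, only
the second entry and its `q` matter, a problem in `𝔽_p ^ 2` solved by `exists_zeroSum_card_le`.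
Otherwise, after at most `2 * p` vectors are discarded, fewer than `p` of those remain, and the
defining property of `C₀` is applied to both residues and the `q` of the first entry.
-/

/-! ### Zero sums in `𝔽_p ^ d` by alternating sums over subsets -/

open Finset

theorem sum_Icc_neg_one_pow_card_eq_zero {ι R : Type*} [DecidableEq ι] [CommRing R]
    {S T : Finset ι} (h : #T < #S) :
    ∑ I ∈ Icc T S, (-1 : R) ^ #I = 0 := by
  obtain ⟨x, hxS, hxT⟩ := exists_mem_notMem_of_card_lt_card h
  -- adding or removing `x` pairs the sets of opposite sign
  have hdis : Disjoint (Icc T (S.erase x)) ((Icc T (S.erase x)).image (insert x)) := by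
    rw [disjoint_left]
    intro I hI hI'
    obtain ⟨J, -, rfl⟩ := mem_image.1 hI'
    exact notMem_erase x S ((mem_Icc.1 hI).2 (mem_insert_self x J))
  have hU : Icc T S = Icc T (S.erase x) ∪ (Icc T (S.erase x)).image (insert x) := by
    ext I
    simp only [mem_union, mem_image, mem_Icc]
    constructor
    · rintro ⟨h1, h2⟩
      by_cases hx : x ∈ I
      · refine Or.inr ⟨I.erase x, ⟨?_, erase_subset_erase x h2⟩, insert_erase hx⟩
        exact fun i hi => mem_erase.2 ⟨fun e => hxT (e ▸ hi), h1 hi⟩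
      · exact Or.inl ⟨h1, fun i hi => mem_erase.2 ⟨fun e => hx (e ▸ hi), h2 hi⟩⟩
    · rintro (⟨h1, h2⟩ | ⟨J, ⟨h1, h2⟩, rfl⟩)
      · exact ⟨h1, h2.trans (erase_subset x S)⟩
      · exact ⟨h1.trans (subset_insert x J),
          insert_subset hxS (h2.trans (erase_subset x S))⟩
  have hnot : ∀ I ∈ Icc T (S.erase x), x ∉ I := fun I hI hx =>
    notMem_erase x S ((mem_Icc.1 hI).2 hx)
  rw [hU, sum_union hdis, sum_image, ← sum_add_distrib]
  · refine sum_eq_zero fun I hI => ?_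
    rw [card_insert_of_notMem (hnot I hI), pow_succ]
    ring
  · intro I hI J hJ hIJ
    rw [← erase_insert (hnot I hI), hIJ, erase_insert (hnot J hJ)]

/-- The alternating sum over `T ⊆ I ⊆ S` of a product of fewer than `#S - #T` affine functions of the
indicator vector of `I` vanishes. Expanding one factor, each of its coordinates adds one element
to `T`. -/
theorem sum_Icc_neg_one_pow_card_mul_prod_eq_zero {ι κ R : Type*} [DecidableEq ι] [DecidableEq κ]
    [CommRing R] (S : Finset ι) (K : Finset κ) (c : κ → R) (a : κ → ι → R) :
    ∀ T ⊆ S, #T + #K < #S →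
      ∑ I ∈ Icc T S, (-1 : R) ^ #I * ∏ k ∈ K, (c k + ∑ i ∈ I, a k i) = 0 := by
  induction K using Finset.induction_on with
  | empty =>
    intro T hT h
    simpa using sum_Icc_neg_one_pow_card_eq_zero (R := R) (by simpa using h)
  | insert k K hk ih =>
    intro T hT h
    rw [card_insert_of_notMem hk] at h
    have key : ∀ i ∈ S, ∑ I ∈ Icc T S,
        (if i ∈ I then (-1 : R) ^ #I * ∏ k ∈ K, (c k + ∑ i ∈ I, a k i) else 0) = 0 := by
      intro i hi
      rw [← sum_filter]
      have : {I ∈ Icc T S | i ∈ I} = Icc (insert i T) S := by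
        ext I
        simp only [mem_filter, mem_Icc, insert_subset_iff]
        tauto
      rw [this]
      exact ih _ (insert_subset hi hT) (by have := card_insert_le i T; omega)
    calc _ = ∑ I ∈ Icc T S, (c k * ((-1 : R) ^ #I * ∏ k ∈ K, (c k + ∑ i ∈ I, a k i)) +
          ∑ i ∈ S, a k i *
            (if i ∈ I then (-1 : R) ^ #I * ∏ k ∈ K, (c k + ∑ i ∈ I, a k i) else 0)) := by
          refine sum_congr rfl fun I hI => ?_
          have hIS : I ⊆ S := (mem_Icc.1 hI).2
          rw [prod_insert hk]
          have : ∑ i ∈ S, a k i *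
              (if i ∈ I then (-1 : R) ^ #I * ∏ k ∈ K, (c k + ∑ i ∈ I, a k i) else 0) =
              (∑ i ∈ I, a k i) * ((-1 : R) ^ #I * ∏ k ∈ K, (c k + ∑ i ∈ I, a k i)) := by
            rw [sum_mul]
            simp only [mul_ite, mul_zero]
            rw [← sum_filter, filter_mem_eq_inter, inter_eq_right.2 hIS]
          rw [this]
          ring
      _ = 0 := by
          rw [sum_add_distrib, ← mul_sum, ih T hT (by omega), sum_comm, mul_zero, zero_add]
          refine sum_eq_zero fun i hi => ?_
          rw [← mul_sum, key i hi, mul_zero]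

section ZeroSum

variable {p : ℕ} [Fact p.Prime] {ι : Type*} {d : ℕ}

/-- A product of `d * (p - 1)` affine functions of the indicator vector of `I`; it is nonzero
exactly when the vectors `a i`, `i ∈ I`, sum to zero. -/
noncomputable def zeroSumDetector (a : ι → Fin d → ZMod p) (I : Finset ι) : ZMod p :=
  ∏ k : Fin d × (ZMod p)ˣ, (-(k.2 : ZMod p) + ∑ i ∈ I, a i k.1)

theorem zeroSumDetector_eq_zero {a : ι → Fin d → ZMod p} {I : Finset ι}
    (h : ∑ i ∈ I, a i ≠ 0) : zeroSumDetector a I = 0 := by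
  obtain ⟨j, hj⟩ := Function.ne_iff.1 h
  rw [Finset.sum_apply, Pi.zero_apply] at hj
  exact prod_eq_zero (mem_univ (j, Units.mk0 _ hj)) (by simp)

theorem zeroSumDetector_empty_ne_zero (a : ι → Fin d → ZMod p) : zeroSumDetector a ∅ ≠ 0 := by
  simp [zeroSumDetector, prod_ne_zero_iff]

theorem sum_cons_one_eq_zero_iff (a : ι → Fin d → ZMod p) (I : Finset ι) :
    ∑ i ∈ I, (Fin.cons 1 (a i) : Fin (d + 1) → ZMod p) = 0 ↔ p ∣ #I ∧ ∑ i ∈ I, a i = 0 := by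
  rw [funext_iff, Fin.forall_fin_succ, funext_iff]
  simp [Finset.sum_apply, ZMod.natCast_eq_zero_iff]

variable [DecidableEq ι]

theorem sum_Icc_zeroSumDetector_eq_zero (a : ι → Fin d → ZMod p) {S T : Finset ι} (hT : T ⊆ S)
    (h : #T + d * (p - 1) < #S) :
    ∑ I ∈ Icc T S, (-1 : ZMod p) ^ #I * zeroSumDetector a I = 0 := by
  refine sum_Icc_neg_one_pow_card_mul_prod_eq_zero S univ
    (fun k : Fin d × (ZMod p)ˣ => -(k.2 : ZMod p)) (fun k i => a i k.1) T hT ?_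
  rw [card_univ, Fintype.card_prod, Fintype.card_fin, ZMod.card_units]
  exact h

/-- The Davenport constant of `𝔽_p ^ d` is at most `d * (p - 1) + 1`. -/
theorem exists_nonempty_zeroSum (a : ι → Fin d → ZMod p) {S : Finset ι}
    (h : d * (p - 1) < #S) : ∃ I ⊆ S, I.Nonempty ∧ ∑ i ∈ I, a i = 0 := by
  by_contra! hcon
  have h0 := sum_Icc_zeroSumDetector_eq_zero a (empty_subset S) (by simpa using h)
  rw [sum_eq_single ∅] at h0
  · exact zeroSumDetector_empty_ne_zero a (by simpa using h0)
  · intro I hI hne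
    rw [zeroSumDetector_eq_zero (hcon I (mem_Icc.1 hI).2 (nonempty_iff_ne_empty.2 hne)), mul_zero]
  · simp

/-- Multiplying the detector by the polynomial `(#I).choose p - 2` of degree `p` in the indicator
vector excludes the zero-sum sets whose size is `2 * p`. -/
theorem exists_nonempty_zeroSum_choose_ne_two (hp : p ≠ 2) (a : ι → Fin d → ZMod p)
    {S : Finset ι} (h : d * (p - 1) + p < #S) :
    ∃ I ⊆ S, I.Nonempty ∧ ∑ i ∈ I, a i = 0 ∧ ((#I).choose p : ZMod p) ≠ 2 := by
  by_contra! hcon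
  -- `(#I).choose p` is the sum of the indicators of `T ⊆ I` over the `p`-element sets `T`
  have h1 : ∑ I ∈ Icc ∅ S, (-1 : ZMod p) ^ #I * zeroSumDetector a I * ((#I).choose p) = 0 := by
    calc _ = ∑ I ∈ Icc ∅ S, ∑ T ∈ S.powersetCard p,
          (if T ⊆ I then (-1 : ZMod p) ^ #I * zeroSumDetector a I else 0) := by
          refine sum_congr rfl fun I hI => ?_
          have : {T ∈ S.powersetCard p | T ⊆ I} = I.powersetCard p := by
            ext T
            simp only [mem_filter, mem_powersetCard]
            exact ⟨fun h => ⟨h.2, h.1.2⟩, fun h => ⟨⟨h.1.trans (mem_Icc.1 hI).2, h.2⟩, h.1⟩⟩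
          rw [← sum_filter, this, sum_const, card_powersetCard, nsmul_eq_mul, mul_comm]
      _ = 0 := by
          rw [sum_comm]
          refine sum_eq_zero fun T hT => ?_
          rw [mem_powersetCard] at hT
          rw [← sum_filter]
          have : {I ∈ Icc ∅ S | T ⊆ I} = Icc T S := by
            ext I
            simp [and_comm]
          rw [this]
          exact sum_Icc_zeroSumDetector_eq_zero a hT.1 (by omega)
  have h2 := sum_Icc_zeroSumDetector_eq_zero a (empty_subset S)
    (by simp only [card_empty]; omega)
  have h3 : ∑ I ∈ Icc ∅ S,
      (-1 : ZMod p) ^ #I * zeroSumDetector a I * ((#I).choose p - 2) = 0 := by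
    simp only [mul_sub, sum_sub_distrib, ← sum_mul, h1, h2]
    simp
  rw [sum_eq_single ∅] at h3
  · have hp0 : 0 < p := (Fact.out : p.Prime).pos
    have h20 : (2 : ZMod p) ≠ 0 := by
      intro h
      have : ((2 : ℕ) : ZMod p) = 0 := by exact_mod_cast h
      rw [ZMod.natCast_eq_zero_iff] at this
      exact hp ((Nat.prime_dvd_prime_iff_eq Fact.out Nat.prime_two).1 this)
    simp [Nat.choose_eq_zero_of_lt hp0, zeroSumDetector_empty_ne_zero, h20] at h3
  · intro I hI hne
    by_cases hs : ∑ i ∈ I, a i = 0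
    · rw [hcon I (mem_Icc.1 hI).2 (nonempty_iff_ne_empty.2 hne) hs, sub_self, mul_zero]
    · rw [zeroSumDetector_eq_zero hs, mul_zero, zero_mul]
  · simp

/-- Among `3 * p - 2` vectors of `𝔽_p ^ 2` some `p` or some `2 * p` have sum zero: appending a
coordinate `1` forces `p` to divide the size of a zero-sum subfamily. -/
theorem exists_zeroSum_card_eq_or (a : ι → Fin 2 → ZMod p) {S : Finset ι} (h : 3 * p ≤ #S + 2) :
    ∃ I ⊆ S, (#I = p ∨ #I = 2 * p) ∧ ∑ i ∈ I, a i = 0 := by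
  have hp := (Fact.out : p.Prime).two_le
  obtain ⟨S', hS', hc⟩ := exists_subset_card_eq (show 3 * p - 2 ≤ #S by omega)
  obtain ⟨I, hI, hne, hs⟩ := exists_nonempty_zeroSum
    (fun i => (Fin.cons 1 (a i) : Fin 3 → ZMod p)) (S := S') (by omega)
  rw [sum_cons_one_eq_zero_iff] at hs
  obtain ⟨⟨k, hk⟩, hs⟩ := hs
  refine ⟨I, hI.trans hS', ?_, hs⟩
  have h1 := card_le_card hI
  have h2 := hne.card_pos
  have hk3 : k < 3 := by
    by_contra! hk3
    have := Nat.mul_le_mul_left p hk3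
    omega
  interval_cases k <;> omega

/-- Among `3 * p - 2` vectors of `𝔽_p ^ 2` some nonempty subfamily of at most `p` has sum zero: a
zero-sum family of size `2 * p` splits into two by the bound for the Davenport constant. -/
theorem exists_zeroSum_card_le (a : ι → Fin 2 → ZMod p) {S : Finset ι} (h : 3 * p ≤ #S + 2) :
    ∃ I ⊆ S, I.Nonempty ∧ #I ≤ p ∧ ∑ i ∈ I, a i = 0 := by
  have hp := (Fact.out : p.Prime).two_le
  obtain ⟨I, hI, hc | hc, hs⟩ := exists_zeroSum_card_eq_or a h
  · exact ⟨I, hI, card_pos.1 (by omega), hc.le, hs⟩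
  obtain ⟨I', hI', hc'⟩ := exists_subset_card_eq (show 2 * p - 1 ≤ #I by omega)
  obtain ⟨J, hJ, hne, hJs⟩ := exists_nonempty_zeroSum a (S := I') (by omega)
  have hJc := card_le_card hJ
  have hJI := hJ.trans hI'
  by_cases hJp : #J ≤ p
  · exact ⟨J, hJI.trans hI, hne, hJp, hJs⟩
  · have hd := card_sdiff_of_subset hJI
    refine ⟨I \ J, sdiff_subset.trans hI, card_pos.1 (by omega), by omega, ?_⟩
    have := sum_sdiff (f := a) hJI
    rwa [hs, hJs, add_zero] at this

/-- Among `4 * p - 2` vectors of `𝔽_p ^ 2` some `p` have sum zero. A zero-sum family of size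
`3 * p` contains, after one vector is dropped, a zero-sum family of size `p` or `2 * p`, and the
complement of the latter in the whole family has size `p`. -/
theorem exists_zeroSum_card_eq (hp2 : p ≠ 2) (a : ι → Fin 2 → ZMod p) {S : Finset ι}
    (h : 4 * p ≤ #S + 2) : ∃ I ⊆ S, #I = p ∧ ∑ i ∈ I, a i = 0 := by
  have hp := (Fact.out : p.Prime).two_le
  obtain ⟨S', hS', hc⟩ := exists_subset_card_eq (show 4 * p - 2 ≤ #S by omega)
  obtain ⟨I, hI, hne, hs, hch⟩ := exists_nonempty_zeroSum_choose_ne_two hp2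
    (fun i => (Fin.cons 1 (a i) : Fin 3 → ZMod p)) (S := S') (by omega)
  rw [sum_cons_one_eq_zero_iff] at hs
  obtain ⟨⟨k, hk⟩, hs⟩ := hs
  have h1 := card_le_card hI
  have h2 := hne.card_pos
  have hk4 : k < 4 := by
    by_contra! hk4
    have := Nat.mul_le_mul_left p hk4
    omega
  have hk2 : k ≠ 2 := by
    rintro rfl
    refine hch ?_
    -- Lucas: `(2 * p).choose p ≡ 2` modulo `p`
    rw [hk]
    have := Choose.choose_modEq_choose_mod_mul_choose_div_nat (n := p * 2) (k := p) (p := p)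
    rw [← ZMod.natCast_eq_natCast_iff] at this
    rw [this]
    simp [Nat.div_self (by omega : 0 < p), Nat.mul_div_cancel_left 2 (by omega : 0 < p)]
  obtain rfl | rfl : k = 1 ∨ k = 3 := by
    have : k ≠ 0 := by rintro rfl; omega
    omega
  · exact ⟨I, hI.trans hS', by omega, hs⟩
  obtain ⟨I', hI', hc'⟩ := exists_subset_card_eq (show 3 * p - 1 ≤ #I by omega)
  obtain ⟨J, hJ, hJc, hJs⟩ := exists_zeroSum_card_eq_or a (S := I') (by omega)
  have hJI := hJ.trans hI'
  obtain hJc | hJc := hJc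
  · exact ⟨J, hJI.trans (hI.trans hS'), hJc, hJs⟩
  · have hd := card_sdiff_of_subset hJI
    refine ⟨I \ J, sdiff_subset.trans (hI.trans hS'), by omega, ?_⟩
    have := sum_sdiff (f := a) hJI
    rwa [hs, hJs, add_zero] at this

end ZeroSum

/-! ### Expansion of sets under translation, by Fourier analysis -/

/-- The number of elements of `Y` which leave `Y` under translation by `d`. -/
def exitCard {V : Type*} [Add V] [DecidableEq V] (Y : Finset V) (d : V) : ℕ :=
  #{y ∈ Y | y + d ∉ Y}

section ExitCard

variable {V : Type*} [AddCommGroup V] [DecidableEq V] (Y : Finset V)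

theorem exitCard_zero : exitCard Y 0 = 0 := by
  simp [exitCard]

theorem exitCard_add_le (d e : V) : exitCard Y (d + e) ≤ exitCard Y d + exitCard Y e := by
  have h : {y ∈ Y | y + (d + e) ∉ Y} ⊆
      {y ∈ Y | y + d ∉ Y} ∪ {y ∈ Y | y + e ∉ Y}.image (· - d) := by
    intro y hy
    simp only [mem_union, mem_filter, mem_image] at hy ⊢
    by_cases hd : y + d ∈ Y
    · exact Or.inr ⟨y + d, ⟨hd, by rw [add_assoc]; exact hy.2⟩, by abel⟩
    · exact Or.inl ⟨hy.1, hd⟩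
  exact (card_le_card h).trans ((card_union_le _ _).trans (Nat.add_le_add_left card_image_le _))

theorem exitCard_nsmul_le (d : V) (j : ℕ) : exitCard Y (j • d) ≤ j * exitCard Y d := by
  induction j with
  | zero => simp [exitCard_zero]
  | succ j ih =>
    rw [succ_nsmul, Nat.succ_mul]
    exact (exitCard_add_le Y _ _).trans (Nat.add_le_add_right ih _)

theorem card_add_exitCard_le_card_union_image_add (a b : V) :
    #Y + exitCard Y (b - a) ≤ #(Y.image (· + a) ∪ Y.image (· + b)) := by
  have hsub : Y.image (· + a) ∪ {y ∈ Y | y + (b - a) ∉ Y}.image (· + b) ⊆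
      Y.image (· + a) ∪ Y.image (· + b) :=
    union_subset_union_right (image_subset_image (filter_subset _ _))
  refine le_trans (le_of_eq ?_) (card_le_card hsub)
  rw [card_union_of_disjoint, card_image_of_injective _ (add_left_injective a),
    card_image_of_injective _ (add_left_injective b), exitCard]
  rw [disjoint_left]
  rintro x hx hx'
  obtain ⟨y, hy, rfl⟩ := mem_image.1 hx
  obtain ⟨z, hz, hzy⟩ := mem_image.1 hx'
  refine (mem_filter.1 hz).2 ?_
  have : z + (b - a) = y := by
    rw [← add_sub_assoc, sub_eq_iff_eq_add]
    exact hzy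
  rwa [this]

end ExitCard

section Fourier

open ZMod Matrix

variable {p : ℕ} [Fact p.Prime] {r : ℕ}

/-- Orthogonality of the characters of `𝔽_p ^ r`. -/
theorem sum_stdAddChar_dotProduct (v : Fin r → ZMod p) :
    ∑ ξ : Fin r → ZMod p, stdAddChar (ξ ⬝ᵥ v) = if v = 0 then (p : ℂ) ^ r else 0 := by
  let φ : (Fin r → ZMod p) →+ ZMod p :=
    { toFun := fun ξ => ξ ⬝ᵥ v
      map_zero' := zero_dotProduct v
      map_add' := fun x y => add_dotProduct x y v }
  have h := AddChar.sum_eq_ite ((stdAddChar (N := p)).compAddMonoidHom φ)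
  have hφ : (stdAddChar (N := p)).compAddMonoidHom φ = 0 ↔ v = 0 := by
    constructor
    · intro h0
      ext j
      have := DFunLike.congr_fun h0 (Pi.single j 1)
      rw [AddChar.compAddMonoidHom_apply, AddChar.zero_apply,
        ← AddChar.map_zero_eq_one (stdAddChar (N := p))] at this
      simpa [φ] using injective_stdAddChar this
    · rintro rfl
      ext ξ
      simp [φ]
  simp only [hφ] at h
  simpa [φ, ZMod.card] using h

/-- The Fourier transform of the indicator function of `Y`. -/
noncomputable def indicatorFourier (Y : Finset (Fin r → ZMod p)) (ξ : Fin r → ZMod p) : ℂ :=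
  ∑ y ∈ Y, stdAddChar (ξ ⬝ᵥ y)

theorem sum_normSq_indicatorFourier_mul (Y : Finset (Fin r → ZMod p)) (d : Fin r → ZMod p) :
    ∑ ξ, (Complex.normSq (indicatorFourier Y ξ) : ℂ) * stdAddChar (ξ ⬝ᵥ d) =
      (p : ℂ) ^ r * #{y ∈ Y | y + d ∈ Y} := by
  calc _ = ∑ ξ : Fin r → ZMod p, ∑ y ∈ Y, ∑ z ∈ Y, stdAddChar (ξ ⬝ᵥ (y + d - z)) := by
        refine sum_congr rfl fun ξ _ => ?_
        rw [← Complex.mul_conj, indicatorFourier, map_sum, sum_mul_sum, sum_mul]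
        refine sum_congr rfl fun y _ => ?_
        rw [sum_mul]
        refine sum_congr rfl fun z _ => ?_
        rw [← AddChar.map_neg_eq_conj, ← AddChar.map_add_eq_mul, ← AddChar.map_add_eq_mul,
          dotProduct_sub, dotProduct_add]
        congr 1
        ring
    _ = ∑ y ∈ Y, ∑ z ∈ Y, if y + d = z then (p : ℂ) ^ r else 0 := by
        rw [sum_comm]
        refine sum_congr rfl fun y _ => ?_
        rw [sum_comm]
        refine sum_congr rfl fun z _ => ?_
        rw [sum_stdAddChar_dotProduct]
        simp only [sub_eq_zero]
    _ = _ := by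
        simp only [sum_ite_eq]
        rw [← sum_filter, sum_const, nsmul_eq_mul, mul_comm]

/-- Parseval's identity for the indicator function of `Y`. -/
theorem sum_normSq_indicatorFourier (Y : Finset (Fin r → ZMod p)) :
    ∑ ξ, Complex.normSq (indicatorFourier Y ξ) = (p : ℝ) ^ r * #Y := by
  have h := sum_normSq_indicatorFourier_mul Y 0
  simp only [dotProduct_zero, AddChar.map_zero_eq_one, mul_one, add_zero, filter_mem_eq_inter,
    inter_self] at h
  exact_mod_cast h

/-- `exitCard Y d` in terms of the Fourier transform of `Y`: each mode contributes its energy times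
its displacement under translation by `d`. -/
theorem sum_normSq_indicatorFourier_mul_one_sub (Y : Finset (Fin r → ZMod p))
    (d : Fin r → ZMod p) :
    ∑ ξ, Complex.normSq (indicatorFourier Y ξ) * (1 - (stdAddChar (ξ ⬝ᵥ d)).re) =
      (p : ℝ) ^ r * exitCard Y d := by
  have h := congrArg Complex.re (sum_normSq_indicatorFourier_mul Y d)
  rw [Complex.re_sum] at h
  simp only [Complex.re_ofReal_mul] at h
  have h2 : ((p : ℂ) ^ r * #{y ∈ Y | y + d ∈ Y}).re = (p : ℝ) ^ r * #{y ∈ Y | y + d ∈ Y} := by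
    exact_mod_cast Complex.ofReal_re ((p : ℝ) ^ r * #{y ∈ Y | y + d ∈ Y})
  rw [h2] at h
  simp only [mul_sub, mul_one, sum_sub_distrib]
  rw [h, sum_normSq_indicatorFourier, exitCard, ← card_filter_add_card_filter_not (s := Y)
    (fun y => y + d ∈ Y)]
  push_cast
  ring

/-- The powers of a root of unity at distance at least `4 * s / p` from `1` form a geometric sum of
bounded norm; the distance is bounded below by Jordan's inequality for the sine. -/
theorem norm_sum_stdAddChar_pow_le (t : ZMod p) {s : ℕ} (hs : 0 < s) (h : s ≤ t.valMinAbs.natAbs)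
    (m : ℕ) : ‖∑ j ∈ range m, stdAddChar t ^ j‖ ≤ p / (2 * s) := by
  have hp : (0 : ℝ) < p := by exact_mod_cast (Fact.out : p.Prime).pos
  have hs' : (0 : ℝ) < s := by exact_mod_cast hs
  set u : ℤ := t.valMinAbs with hu
  have hnorm : ‖stdAddChar t - 1‖ = 2 * |Real.sin (Real.pi * u / p)| := by
    have h1 : stdAddChar t = Complex.exp (Complex.I * ((2 * Real.pi * u / p : ℝ) : ℂ)) := by
      conv_lhs => rw [← t.coe_valMinAbs, stdAddChar_coe, ← hu]
      congr 1
      push_cast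
      ring
    rw [h1, Complex.norm_exp_I_mul_ofReal_sub_one, norm_mul, Real.norm_eq_abs, Real.norm_eq_abs,
      abs_two]
    congr 3
    ring
  have hlow : 4 * s / (p : ℝ) ≤ ‖stdAddChar t - 1‖ := by
    have habs : |Real.sin (Real.pi * u / p)| = |Real.sin (Real.pi * u.natAbs / p)| := by
      rw [Nat.cast_natAbs, Int.cast_abs]
      rcases abs_choice (u : ℝ) with h | h
      · rw [h]
      · rw [h, mul_neg, neg_div, Real.sin_neg, abs_neg]
    have hle : ((u.natAbs : ℕ) : ℝ) ≤ p / 2 := by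
      have h1 : 2 * u.natAbs ≤ p := by have := t.natAbs_valMinAbs_le; omega
      have h2 : (2 : ℝ) * u.natAbs ≤ p := by exact_mod_cast h1
      linarith
    have hsin := Real.mul_le_sin (x := Real.pi * u.natAbs / p) (by positivity) (by
      rw [div_le_div_iff₀ hp two_pos]
      nlinarith [Real.pi_pos])
    have h3 : 2 / Real.pi * (Real.pi * u.natAbs / p) = 2 * u.natAbs / p := by
      field_simp
    rw [h3] at hsin
    have h4 : (s : ℝ) ≤ u.natAbs := by exact_mod_cast h
    have h5 : 4 * (s : ℝ) / p ≤ 2 * (2 * u.natAbs / p) := by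
      rw [← mul_div_assoc, ← mul_assoc]
      norm_num1
      gcongr
    rw [hnorm, habs]
    linarith [le_abs_self (Real.sin (Real.pi * u.natAbs / p))]
  have hgeom : ‖∑ j ∈ range m, stdAddChar t ^ j‖ * ‖stdAddChar t - 1‖ ≤ 2 := by
    rw [← norm_mul, geom_sum_mul]
    refine (norm_sub_le _ _).trans ?_
    rw [norm_pow, AddChar.norm_apply, one_pow, norm_one]
    norm_num
  rw [le_div_iff₀ (by positivity)]
  have h6 := mul_le_mul_of_nonneg_left hlow (norm_nonneg (∑ j ∈ range m, stdAddChar t ^ j))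
  have h7 := h6.trans hgeom
  rw [mul_div_assoc', div_le_iff₀ hp] at h7
  linarith

theorem card_filter_natAbs_valMinAbs_lt_le {ι : Type*} (A : Finset ι) (g : ι → ZMod p) {M s : ℕ}
    (hM : ∀ t, #{i ∈ A | g i = t} ≤ M) :
    #{i ∈ A | (g i).valMinAbs.natAbs < s} ≤ 2 * s * M := by
  classical
  have h : {i ∈ A | (g i).valMinAbs.natAbs < s} ⊆
      ((Ioo (-s : ℤ) s).image (Int.cast : ℤ → ZMod p)).biUnion fun t => {i ∈ A | g i = t} := by
    intro i hi
    rw [mem_filter] at hi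
    refine mem_biUnion.2 ⟨g i, mem_image.2 ⟨(g i).valMinAbs, ?_, (g i).coe_valMinAbs⟩,
      mem_filter.2 ⟨hi.1, rfl⟩⟩
    rw [mem_Ioo]
    omega
  refine (card_le_card h).trans (card_biUnion_le.trans ((sum_le_card_nsmul _ _ M
    fun t _ => hM t).trans ?_))
  rw [smul_eq_mul]
  refine Nat.mul_le_mul_right M (card_image_le.trans ?_)
  rw [Int.card_Ioo]
  omega

/-- If the values of `g` on `A` are spread over many residues, the multiples `j * g i` are on
average far from `0`. -/
theorem card_mul_le_sum_sum_one_sub_re {ι : Type*} (A : Finset ι) (g : ι → ZMod p) {M s m : ℕ}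
    (hs : 0 < s) (hM : ∀ t, #{i ∈ A | g i = t} ≤ M) (hA : 8 * s * M ≤ #A) (hm : p ≤ s * m) :
    3 / 8 * (#A * m : ℝ) ≤ ∑ i ∈ A, ∑ j ∈ range m, (1 - (stdAddChar (j • g i)).re) := by
  have hs' : (0 : ℝ) < s := by exact_mod_cast hs
  have hre : ∀ x : ZMod p, 0 ≤ 1 - (stdAddChar x).re := fun x => by
    have := Complex.re_le_norm (stdAddChar x)
    rw [AddChar.norm_apply] at this
    linarith
  have hbad := card_filter_natAbs_valMinAbs_lt_le A g (s := s) hM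
  have hsplit := card_filter_add_card_filter_not (s := A) (fun i => (g i).valMinAbs.natAbs < s)
  have hcard : 3 * #A ≤ 4 * #{i ∈ A | ¬ (g i).valMinAbs.natAbs < s} := by
    have : 8 * s * M = 4 * (2 * s * M) := by ring
    omega
  have hcard' : 3 * (#A : ℝ) ≤ 4 * #{i ∈ A | ¬ (g i).valMinAbs.natAbs < s} := by
    exact_mod_cast hcard
  have hgood : ∀ i ∈ A.filter (fun i => ¬ (g i).valMinAbs.natAbs < s),
      (m / 2 : ℝ) ≤ ∑ j ∈ range m, (1 - (stdAddChar (j • g i)).re) := by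
    intro i hi
    have h1 := norm_sum_stdAddChar_pow_le (g i) hs (not_lt.1 (mem_filter.1 hi).2) m
    have h2 := (Complex.re_le_norm _).trans h1
    rw [Complex.re_sum] at h2
    simp only [AddChar.map_nsmul_eq_pow]
    rw [sum_sub_distrib, sum_const, card_range, nsmul_eq_mul, mul_one]
    have h3 : (p : ℝ) / (2 * s) ≤ m / 2 := by
      rw [div_le_div_iff₀ (by positivity) two_pos]
      have : (p : ℝ) ≤ s * m := by exact_mod_cast hm
      nlinarith
    linarith
  calc 3 / 8 * (#A * m : ℝ) ≤ #{i ∈ A | ¬ (g i).valMinAbs.natAbs < s} * (m / 2 : ℝ) := by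
        have : (0 : ℝ) ≤ m := Nat.cast_nonneg m
        nlinarith
    _ ≤ ∑ i ∈ A with ¬ (g i).valMinAbs.natAbs < s,
          ∑ j ∈ range m, (1 - (stdAddChar (j • g i)).re) := by
        rw [← nsmul_eq_mul]
        exact card_nsmul_le_sum _ _ _ hgood
    _ ≤ _ := sum_le_sum_of_subset_of_nonneg (filter_subset _ _)
        fun i _ _ => sum_nonneg fun j _ => hre _

/-- Expansion of sets of at most half density: if no affine hyperplane contains more than a
fraction `1 / (8 * s)` of the vectors `w i`, then some difference `w i - x` moves at least
`3 * s / (8 * p)` of `Y` out of `Y`. Averaging over all multiples `j • (w i - x)` with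
`j ≤ p / s`, each nontrivial Fourier mode of `Y` is damped by a constant factor; subadditivity of
`exitCard` then passes from the multiples to the differences themselves. -/
theorem exists_mul_card_le_mul_exitCard {ι : Type*} {A : Finset ι} (hA0 : A.Nonempty)
    (w : ι → Fin r → ZMod p) (x : Fin r → ZMod p) {M s : ℕ} (hs : 0 < s)
    (hM : ∀ ξ : Fin r → ZMod p, ξ ≠ 0 → ∀ t, #{i ∈ A | ξ ⬝ᵥ w i = t} ≤ M)
    (hA : 8 * s * M ≤ #A) {Y : Finset (Fin r → ZMod p)} (hY : 2 * #Y ≤ p ^ r) :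
    ∃ i ∈ A, 3 * s * #Y ≤ 8 * p * exitCard Y (w i - x) := by
  by_contra! hcon
  have hp : (0 : ℝ) < p := by exact_mod_cast (Fact.out : p.Prime).pos
  have hs' : (0 : ℝ) < s := by exact_mod_cast hs
  set m : ℕ := p / s + 1 with hmdef
  have hm : p ≤ s * m := (Nat.lt_mul_div_succ p hs).le
  have hAc : (0 : ℝ) < #A := by exact_mod_cast hA0.card_pos
  have hm0 : (0 : ℝ) < m := by rw [hmdef]; positivity
  have hms : ((m : ℝ) - 1) * s ≤ p := by
    have : p / s * s ≤ p := Nat.div_mul_le_self p s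
    rw [hmdef]
    push_cast
    rw [add_sub_cancel_right]
    exact_mod_cast this
  have hY0 : (0 : ℝ) < #Y := by
    obtain ⟨i, hi⟩ := hA0
    have := hcon i hi
    have : 0 < 3 * s * #Y := by omega
    exact_mod_cast Nat.pos_of_mul_pos_left this
  -- upper bound from subadditivity, lower bound from the Fourier modes
  have hup : ∑ i ∈ A, ∑ j ∈ range m, (exitCard Y (j • (w i - x)) : ℝ) < 3 / 16 * (#A * m * #Y) := by
    have hstep : ∀ i ∈ A, ∑ j ∈ range m, (exitCard Y (j • (w i - x)) : ℝ) ≤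
        m * (m - 1) / 2 * ((3 * s * #Y - 1) / (8 * p)) := by
      intro i hi
      have h1 : (exitCard Y (w i - x) : ℝ) ≤ (3 * s * #Y - 1) / (8 * p) := by
        rw [le_div_iff₀ (by positivity), le_sub_iff_add_le]
        have := Nat.succ_le_of_lt (hcon i hi)
        rw [← Nat.add_one, mul_comm (8 * p)] at this
        exact_mod_cast this
      have h2 : ∑ j ∈ range m, (j : ℝ) = m * (m - 1) / 2 := by
        have := congrArg (Nat.cast : ℕ → ℝ) (sum_range_id_mul_two m)
        rw [eq_div_iff two_ne_zero, ← Nat.cast_sum, hmdef]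
        rw [hmdef, Nat.add_sub_cancel] at this
        push_cast at this ⊢
        rw [add_sub_cancel_right, this]
      calc _ ≤ ∑ j ∈ range m, (j : ℝ) * ((3 * s * #Y - 1) / (8 * p)) := by
            refine sum_le_sum fun j _ => ?_
            refine le_trans ?_ (mul_le_mul_of_nonneg_left h1 (Nat.cast_nonneg j))
            exact_mod_cast exitCard_nsmul_le Y (w i - x) j
        _ = _ := by rw [← sum_mul, h2]
    refine (sum_le_card_nsmul _ _ _ hstep).trans_lt ?_
    rw [nsmul_eq_mul]
    have h3 : ((m : ℝ) - 1) * (3 * s * #Y - 1) < 3 * #Y * p := by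
      have h4 := mul_le_mul_of_nonneg_left hms (show 0 ≤ 3 * (#Y : ℝ) by positivity)
      have h5 : 0 ≤ (m : ℝ) - 1 := by rw [hmdef]; push_cast; simp
      rcases h5.eq_or_lt with h6 | h6
      · rw [← h6, zero_mul]; positivity
      · linarith
    have h7 : (#A : ℝ) * (m * (m - 1) / 2 * ((3 * s * #Y - 1) / (8 * p))) =
        #A * m / (16 * p) * (((m : ℝ) - 1) * (3 * s * #Y - 1)) := by
      field_simp
      ring
    have h8 : 3 / 16 * ((#A : ℝ) * m * #Y) = #A * m / (16 * p) * (3 * #Y * p) := by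
      field_simp
    rw [h7, h8]
    exact mul_lt_mul_of_pos_left h3 (by positivity)
  have hlow : 3 / 8 * (#A * m : ℝ) * ((p : ℝ) ^ r * #Y - (#Y : ℝ) ^ 2) ≤
      (p : ℝ) ^ r * ∑ i ∈ A, ∑ j ∈ range m, (exitCard Y (j • (w i - x)) : ℝ) := by
    have hzero : Complex.normSq (indicatorFourier Y 0) = (#Y : ℝ) ^ 2 := by
      simp [indicatorFourier, pow_two]
    have hrest := add_sum_erase univ (fun ξ => Complex.normSq (indicatorFourier Y ξ))
      (mem_univ (0 : Fin r → ZMod p))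
    simp only [hzero, sum_normSq_indicatorFourier] at hrest
    rw [← hrest, add_sub_cancel_left]
    simp only [mul_sum, ← sum_normSq_indicatorFourier_mul_one_sub]
    have hswap : ∑ i ∈ A, ∑ j ∈ range m, ∑ ξ, Complex.normSq (indicatorFourier Y ξ) *
          (1 - (stdAddChar (ξ ⬝ᵥ j • (w i - x))).re) =
        ∑ ξ, Complex.normSq (indicatorFourier Y ξ) *
          ∑ i ∈ A, ∑ j ∈ range m, (1 - (stdAddChar (j • (ξ ⬝ᵥ (w i - x)))).re) := by
      simp only [mul_sum]
      rw [eq_comm, sum_comm]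
      refine sum_congr rfl fun i _ => ?_
      rw [sum_comm]
      simp only [dotProduct_smul]
    rw [hswap, ← add_sum_erase univ _ (mem_univ (0 : Fin r → ZMod p))]
    refine le_add_of_nonneg_of_le (by simp) (sum_le_sum fun ξ hξ => ?_)
    rw [mul_comm]
    refine mul_le_mul_of_nonneg_left ?_ (Complex.normSq_nonneg _)
    refine card_mul_le_sum_sum_one_sub_re A (fun i => ξ ⬝ᵥ (w i - x)) hs (fun t => ?_) hA hm
    simp only [dotProduct_sub, sub_eq_iff_eq_add]
    exact hM ξ (ne_of_mem_erase hξ) _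
  have hpr : (0 : ℝ) < (p : ℝ) ^ r := by positivity
  have hY' : 2 * (#Y : ℝ) ≤ (p : ℝ) ^ r := by exact_mod_cast hY
  have h9 := mul_lt_mul_of_pos_left hup hpr
  have h10 : 3 / 16 * (#A * m * #Y : ℝ) * (p : ℝ) ^ r ≤
      3 / 8 * (#A * m : ℝ) * ((p : ℝ) ^ r * #Y - (#Y : ℝ) ^ 2) := by
    have h11 : 0 ≤ (#A * m * #Y : ℝ) * ((p : ℝ) ^ r - 2 * #Y) :=
      mul_nonneg (by positivity) (sub_nonneg.2 hY')
    nlinarith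
  linarith

end Fourier

/-! ### Growth of small sets, by the Loomis–Whitney inequality -/

/-- The Loomis–Whitney inequality for a finite set with three jointly injective coordinates. -/
theorem sq_card_le_card_image_mul_card_image_mul_card_image {V α β γ : Type*} [DecidableEq α]
    [DecidableEq β] [DecidableEq γ] (Y : Finset V) (f : V → α) (g : V → β) (h : V → γ)
    (hinj : ∀ y z, f y = f z → g y = g z → h y = h z → y = z) :
    #Y ^ 2 ≤ #(Y.image fun y => (f y, g y)) * #(Y.image fun y => (f y, h y)) *
      #(Y.image fun y => (g y, h y)) := by
  set P := Y.image fun y => (f y, g y) with hP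
  set F : α × β → Finset V := fun c => {y ∈ Y | (f y, g y) = c} with hF
  have hY : #Y = ∑ c ∈ P, #(F c) :=
    card_eq_sum_card_fiberwise fun y hy => mem_image_of_mem _ hy
  have hsq : ∑ c ∈ P, #(F c) ^ 2 ≤
      #(Y.image fun y => (f y, h y)) * #(Y.image fun y => (g y, h y)) := by
    calc ∑ c ∈ P, #(F c) ^ 2 = #(P.sigma fun c => F c ×ˢ F c) := by
          rw [card_sigma]
          exact sum_congr rfl fun c _ => by rw [card_product, pow_two]
      _ ≤ #((Y.image fun y => (f y, h y)) ×ˢ (Y.image fun y => (g y, h y))) := by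
          refine card_le_card_of_injOn
            (fun x => ((f x.2.1, h x.2.1), (g x.2.2, h x.2.2))) ?_ ?_
          · rintro ⟨c, y, z⟩ hx
            simp only [coe_sigma, Set.mem_sigma_iff, mem_coe, mem_product, hF, mem_filter] at hx
            exact mem_product.2 ⟨mem_image_of_mem _ hx.2.1.1, mem_image_of_mem _ hx.2.2.1⟩
          · rintro ⟨c, y, z⟩ hx ⟨c', y', z'⟩ hx' heq
            simp only [coe_sigma, Set.mem_sigma_iff, mem_coe, mem_product, hF, mem_filter] at hx hx'
            simp only [Prod.mk.injEq] at heq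
            obtain ⟨-, ⟨-, hy⟩, -, hz⟩ := hx
            obtain ⟨-, ⟨-, hy'⟩, -, hz'⟩ := hx'
            obtain ⟨⟨h1, h2⟩, h3, h4⟩ := heq
            have hc : c = c' := by
              refine Prod.ext ?_ ?_
              · rw [← hy, ← hy']; exact h1
              · rw [← hz, ← hz']; exact h3
            subst hc
            have h5 := hy.trans hy'.symm
            have h6 := hz.trans hz'.symm
            simp only [Prod.mk.injEq] at h5 h6
            rw [hinj y y' h5.1 h5.2 h2, hinj z z' h6.1 h6.2 h4]
      _ = _ := card_product _ _
  calc #Y ^ 2 ≤ #P * ∑ c ∈ P, #(F c) ^ 2 := by rw [hY]; exact sq_sum_le_card_mul_sum_sq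
    _ ≤ _ := by rw [mul_assoc]; exact Nat.mul_le_mul_left _ hsq

section Growth

variable {p : ℕ} [Fact p.Prime] {V : Type*} [AddCommGroup V] [Module (ZMod p) V] [DecidableEq V]

/-- Every `d`-line meeting `Y` is left by some point of `Y` unless all its `p` points are in `Y`;
the map `π` need only be constant on `d`-lines. -/
theorem card_image_mul_le_exitCard_mul_add {β : Type*} [DecidableEq β] (Y : Finset V) {d : V}
    (hd : d ≠ 0) (π : V → β) (hπ : ∀ y, π (y + d) = π y) :
    #(Y.image π) * p ≤ exitCard Y d * p + #Y := by
  have hfib : ∀ c ∈ Y.image π,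
      p ≤ #{y ∈ {y ∈ Y | y + d ∉ Y} | π y = c} * p + #{y ∈ Y | π y = c} := by
    intro c hc
    by_cases hex : ∃ y ∈ Y, y + d ∉ Y ∧ π y = c
    · obtain ⟨y, hy, hyd, hyc⟩ := hex
      have : 0 < #{y ∈ {y ∈ Y | y + d ∉ Y} | π y = c} :=
        card_pos.2 ⟨y, mem_filter.2 ⟨mem_filter.2 ⟨hy, hyd⟩, hyc⟩⟩
      nlinarith
    · push Not at hex
      obtain ⟨y, hy, rfl⟩ := mem_image.1 hc
      have hmem : ∀ j : ℕ, y + j • d ∈ Y ∧ π (y + j • d) = π y := by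
        intro j
        induction j with
        | zero => simpa using hy
        | succ j ih =>
          rw [succ_nsmul, ← add_assoc, hπ]
          refine ⟨?_, ih.2⟩
          by_contra hne
          exact hex _ ih.1 hne ih.2
      have hord : addOrderOf d = p := addOrderOf_eq_prime
        (by rw [← Nat.cast_smul_eq_nsmul (ZMod p), ZMod.natCast_self, zero_smul]) hd
      have hle : #(range p) ≤ #{z ∈ Y | π z = π y} := by
        refine card_le_card_of_injOn (fun j => y + j • d)
          (fun j _ => mem_filter.2 (hmem j)) fun i hi j hj hij => ?_
        refine nsmul_injOn_Iio_addOrderOf (x := d) ?_ ?_ (add_left_cancel hij)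
        · rw [hord]; exact mem_range.1 hi
        · rw [hord]; exact mem_range.1 hj
      rw [card_range] at hle
      omega
  calc #(Y.image π) * p ≤ ∑ c ∈ Y.image π,
        (#{y ∈ {y ∈ Y | y + d ∉ Y} | π y = c} * p + #{y ∈ Y | π y = c}) := by
        rw [← smul_eq_mul]
        exact card_nsmul_le_sum _ _ _ hfib
    _ = _ := by
        rw [sum_add_distrib, ← sum_mul, exitCard,
          ← card_eq_sum_card_fiberwise fun y hy => mem_image_of_mem π (mem_filter.1 hy).1,
          ← card_eq_sum_card_fiberwise fun y hy => mem_image_of_mem π hy]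

/-- Growth of sets of size about `r ^ 3` in dimension three: by the Loomis–Whitney inequality some
direction of a basis has at least `r ^ 2` lines meeting `Y`. -/
theorem exists_add_pow_three_le_card_add_exitCard (b : Module.Basis (Fin 3) (ZMod p) V)
    (Y : Finset V) {r : ℝ} (hr : 1 ≤ r) (hrp : 20 * r ≤ p) (hY : r ^ 3 ≤ #Y) :
    ∃ i, (r + 1 / 5) ^ 3 ≤ #Y + exitCard Y (b i) := by
  by_contra! hcon
  have hY' : (#Y : ℝ) < (r + 1 / 5) ^ 3 :=
    (le_add_of_nonneg_right (Nat.cast_nonneg _)).trans_lt (hcon 0)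
  have hp : (0 : ℝ) < p := by linarith
  have hproj : ∀ {β : Type} [DecidableEq β] (i : Fin 3) (π : V → β),
      (∀ y, π (y + b i) = π y) → (#(Y.image π) : ℝ) < r ^ 2 := by
    intro β _ i π hπ
    have h1 : (#(Y.image π) : ℝ) * p ≤ exitCard Y (b i) * p + #Y := by
      exact_mod_cast card_image_mul_le_exitCard_mul_add (p := p) Y (b.ne_zero i) π hπ
    by_contra! h2
    have h3 := hcon i
    have h4 : (r + 1 / 5) ^ 3 * (20 * r + 1) ≤ 20 * r * (r ^ 3 + r ^ 2) := by
      nlinarith [mul_nonneg (sub_nonneg.2 hr) (sq_nonneg r), mul_nonneg (sub_nonneg.2 hr)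
        (zero_le_one.trans hr)]
    have h5 : r ^ 2 * p ≤ exitCard Y (b i) * p + #Y := (mul_le_mul_of_nonneg_right h2 hp.le).trans h1
    -- `p` enters only through the full lines, and may be replaced by `20 * r`
    have h6 : r ^ 2 + r ^ 3 - (r + 1 / 5) ^ 3 < (r + 1 / 5) ^ 3 / p := by
      rw [lt_div_iff₀ hp]
      nlinarith
    have h7 : (r + 1 / 5) ^ 3 / p ≤ (r + 1 / 5) ^ 3 / (20 * r) := by
      gcongr
    have h8 := h6.trans_le h7
    rw [lt_div_iff₀ (by positivity)] at h8
    nlinarith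
  have hLW := sq_card_le_card_image_mul_card_image_mul_card_image Y (fun y => b.repr y 0)
    (fun y => b.repr y 1) (fun y => b.repr y 2) (fun y z h0 h1 h2 => by
      refine b.ext_elem fun i => ?_
      fin_cases i
      exacts [h0, h1, h2])
  have h01 := hproj 2 (fun y => (b.repr y 0, b.repr y 1)) (by simp)
  have h02 := hproj 1 (fun y => (b.repr y 0, b.repr y 2)) (by simp)
  have h12 := hproj 0 (fun y => (b.repr y 1, b.repr y 2)) (by simp)
  have hLW' : (#Y : ℝ) ^ 2 ≤ #(Y.image fun y => (b.repr y 0, b.repr y 1)) *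
      #(Y.image fun y => (b.repr y 0, b.repr y 2)) *
      #(Y.image fun y => (b.repr y 1, b.repr y 2)) := by
    exact_mod_cast hLW
  have h9 : (r ^ 3) ^ 2 ≤ (#Y : ℝ) ^ 2 := by gcongr
  have h10 : (#(Y.image fun y => (b.repr y 0, b.repr y 1)) : ℝ) *
      #(Y.image fun y => (b.repr y 0, b.repr y 2)) *
      #(Y.image fun y => (b.repr y 1, b.repr y 2)) < r ^ 2 * r ^ 2 * r ^ 2 := by
    gcongr
  have h11 : r ^ 2 * r ^ 2 * r ^ 2 = (r ^ 3) ^ 2 := by ring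
  linarith

end Growth

/-- Differences from a fixed vector of a family not contained in an affine hyperplane contain a
basis. -/
theorem exists_basis_forall_eq_sub {K ι : Type*} [Field K] {r : ℕ} (A : Finset ι)
    (w : ι → Fin r → K) (x : Fin r → K)
    (h : ∀ ξ : Fin r → K, ξ ≠ 0 → ∀ t, ∃ i ∈ A, ξ ⬝ᵥ w i ≠ t) :
    ∃ b : Module.Basis (Fin r) K (Fin r → K), ∀ j, ∃ i ∈ A, b j = w i - x := by
  set s : Set (Fin r → K) := (fun i => w i - x) '' A with hs
  have hspan : ⊤ ≤ Submodule.span K s := by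
    by_contra hne
    obtain ⟨f, hf0, hf⟩ := Submodule.exists_le_ker_of_lt_top _ (lt_top_iff_ne_top.2
      fun e => hne e.ge)
    obtain ⟨ξ, rfl⟩ := (dotProductEquiv K (Fin r)).surjective f
    obtain ⟨i, hi, hne⟩ := h ξ (by rintro rfl; simp at hf0) (ξ ⬝ᵥ x)
    have := hf (Submodule.subset_span ⟨i, hi, rfl⟩)
    rw [LinearMap.mem_ker, dotProductEquiv_apply_apply, dotProduct_sub, sub_eq_zero] at this
    exact hne this
  let b := Module.Basis.ofSpan hspan
  let e := b.indexEquiv (Pi.basisFun K (Fin r))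
  refine ⟨b.reindex e, fun j => ?_⟩
  rw [Module.Basis.reindex_apply]
  obtain ⟨i, hi, hij⟩ := Module.Basis.ofSpan_subset hspan ⟨e.symm j, rfl⟩
  exact ⟨i, hi, hij.symm⟩

/-! ### Zero sums of length `p` in `𝔽_p ^ 3` -/

/-- Outside the index set `E` there are `2 * k` indices whose `k`-element subfamilies of `w` have
at least `q` different sums. -/
def ManySubsums {ι V : Type*} [AddCommMonoid V] (w : ι → V) (E : Finset ι) (k : ℕ) (q : ℝ) :
    Prop :=
  ∃ (U : Finset ι) (Y : Finset V), Disjoint U E ∧ #U = 2 * k ∧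
    (∀ y ∈ Y, ∃ I ⊆ U, #I = k ∧ ∑ i ∈ I, w i = y) ∧ q ≤ #Y

section ManySubsums

variable {ι V : Type*} [AddCommGroup V] {w : ι → V} {E : Finset ι} {k : ℕ} {q : ℝ}

theorem ManySubsums.mono {q' : ℝ} (h : ManySubsums w E k q) (hq : q' ≤ q) :
    ManySubsums w E k q' := by
  obtain ⟨U, Y, h1, h2, h3, h4⟩ := h
  exact ⟨U, Y, h1, h2, h3, hq.trans h4⟩

theorem manySubsums_zero : ManySubsums w E 0 1 :=
  ⟨∅, {0}, disjoint_empty_left E, rfl,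
    fun y hy => ⟨∅, empty_subset _, rfl, by simpa using (mem_singleton.1 hy).symm⟩, by simp⟩

variable [DecidableEq ι] [DecidableEq V]

/-- Choosing one element from each of `k` pairs, a further pair `a, b` replaces the set `Y` of sums
by `(Y + w a) ∪ (Y + w b)`. -/
theorem ManySubsums.succ_of_exists {q' : ℝ} (h : ManySubsums w E k q)
    (hstep : ∀ U : Finset ι, Disjoint U E → #U = 2 * k → ∀ Y : Finset V, q ≤ #Y →
      ∃ a ∉ U ∪ E, ∃ b ∉ U ∪ E, a ≠ b ∧ q' ≤ #Y + exitCard Y (w b - w a)) :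
    ManySubsums w E (k + 1) q' := by
  obtain ⟨U, Y, hUE, hUc, hY, hq⟩ := h
  obtain ⟨a, ha, b, hb, hab, hle⟩ := hstep U hUE hUc Y hq
  simp only [mem_union, not_or] at ha hb
  refine ⟨insert a (insert b U), Y.image (· + w a) ∪ Y.image (· + w b), ?_, ?_, ?_, ?_⟩
  · simp only [disjoint_insert_left]
    exact ⟨ha.2, hb.2, hUE⟩
  · rw [card_insert_of_notMem, card_insert_of_notMem hb.1, hUc]
    · ring
    · simp [hab, ha.1]
  · have hext : ∀ c ∈ ({a, b} : Finset ι), ∀ y ∈ Y,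
        ∃ I ⊆ insert a (insert b U), #I = k + 1 ∧ ∑ i ∈ I, w i = y + w c := by
      intro c hc y hy
      obtain ⟨I, hIU, hIc, hIs⟩ := hY y hy
      have hcU : c ∉ U := by
        rcases mem_insert.1 hc with rfl | hc
        · exact ha.1
        · rw [mem_singleton.1 hc]; exact hb.1
      have hcI : c ∉ I := fun h => hcU (hIU h)
      refine ⟨insert c I, ?_, by rw [card_insert_of_notMem hcI, hIc], ?_⟩
      · refine insert_subset ?_ (hIU.trans ((subset_insert b U).trans (subset_insert a _)))
        simp only [mem_insert, mem_singleton] at hc ⊢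
        tauto
      · rw [sum_insert hcI, hIs, add_comm]
    intro y hy
    rcases mem_union.1 hy with hy | hy
    · obtain ⟨z, hz, rfl⟩ := mem_image.1 hy
      exact hext a (by simp) z hz
    · obtain ⟨z, hz, rfl⟩ := mem_image.1 hy
      exact hext b (by simp) z hz
  · refine hle.trans ?_
    exact_mod_cast card_add_exitCard_le_card_union_image_add Y (w a) (w b)

end ManySubsums

section Spread

variable {ι : Type*} [DecidableEq ι] [Fintype ι] {p : ℕ} {E : Finset ι} {k : ℕ}

theorem le_card_compl_union (hn : 9994 * p ≤ Fintype.card ι) (hE : #E + 2 * k + 2 ≤ 2 * p)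
    {U : Finset ι} (hU : #U = 2 * k) : 9992 * p ≤ #(U ∪ E)ᶜ := by
  have h1 := card_compl_add_card (U ∪ E)
  have h2 := card_union_le U E
  omega

variable [Fact p.Prime] {w : ι → Fin 3 → ZMod p}

/-- Any further pair keeps the number of sums. -/
theorem ManySubsums.succ {q : ℝ} (hn : 9994 * p ≤ Fintype.card ι)
    (hE : #E + 2 * k + 2 ≤ 2 * p) (h : ManySubsums w E k q) : ManySubsums w E (k + 1) q := by
  refine h.succ_of_exists fun U hUE hU Y hY => ?_
  have hp := (Fact.out : p.Prime).two_le
  have hc := le_card_compl_union hn hE hU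
  obtain ⟨a, ha, b, hb, hab⟩ := one_lt_card.1 (show 1 < #(U ∪ E)ᶜ by omega)
  exact ⟨a, mem_compl.1 ha, b, mem_compl.1 hb, hab,
    hY.trans (le_add_of_nonneg_right (Nat.cast_nonneg _))⟩

theorem ManySubsums.add {q : ℝ} (hn : 9994 * p ≤ Fintype.card ι) (h : ManySubsums w E k q)
    (l : ℕ) (hE : #E + 2 * (k + l) ≤ 2 * p) : ManySubsums w E (k + l) q := by
  induction l with
  | zero => exact h
  | succ l ih => exact (ih (by omega)).succ hn (by omega)

theorem card_filter_compl_lt {U : Finset ι}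
    (hw : ∀ ξ : Fin 3 → ZMod p, ξ ≠ 0 → ∀ t, #{i | ξ ⬝ᵥ w i = t} < 4 * p)
    {ξ : Fin 3 → ZMod p} (hξ : ξ ≠ 0) (t : ZMod p) : #{i ∈ Uᶜ | ξ ⬝ᵥ w i = t} < 4 * p :=
  (card_le_card (filter_subset_filter _ (subset_univ _))).trans_lt (hw ξ hξ t)

/-- One step of the cubic growth of small sets of sums. -/
theorem ManySubsums.succ_of_le_div (hn : 9994 * p ≤ Fintype.card ι)
    (hw : ∀ ξ : Fin 3 → ZMod p, ξ ≠ 0 → ∀ t, #{i | ξ ⬝ᵥ w i = t} < 4 * p)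
    (hE : #E + 2 * k + 2 ≤ 2 * p) {r : ℝ} (hr : 1 ≤ r) (hrp : 20 * r ≤ p)
    (h : ManySubsums w E k (r ^ 3)) : ManySubsums w E (k + 1) ((r + 1 / 5) ^ 3) := by
  refine h.succ_of_exists fun U hUE hU Y hY => ?_
  have hp := (Fact.out : p.Prime).two_le
  have hc := le_card_compl_union hn hE hU
  obtain ⟨a, ha⟩ := card_pos.1 (show 0 < #(U ∪ E)ᶜ by omega)
  obtain ⟨b, hb⟩ := exists_basis_forall_eq_sub (U ∪ E)ᶜ w (w a) fun ξ hξ t => by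
    by_contra! hcon
    have h1 := card_filter_compl_lt (U := U ∪ E) hw hξ t
    rw [filter_true_of_mem hcon] at h1
    omega
  obtain ⟨j, hj⟩ := exists_add_pow_three_le_card_add_exitCard b Y hr hrp hY
  obtain ⟨i, hi, hij⟩ := hb j
  refine ⟨a, mem_compl.1 ha, i, mem_compl.1 hi, ?_, by rwa [← hij]⟩
  rintro rfl
  exact b.ne_zero j (by rw [hij, sub_self])

/-- One step of the exponential growth of the set of sums, until it fills more than half of the
space; as `p ^ 3` is odd, this means at least `(p ^ 3 + 1) / 2` sums. -/
theorem ManySubsums.succ_min (hn : 9994 * p ≤ Fintype.card ι)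
    (hw : ∀ ξ : Fin 3 → ZMod p, ξ ≠ 0 → ∀ t, #{i | ξ ⬝ᵥ w i = t} < 4 * p)
    (hE : #E + 2 * k + 2 ≤ 2 * p) (hodd : Odd p) {q : ℝ} (hq : 0 < q)
    (h : ManySubsums w E k (min q (((p : ℝ) ^ 3 + 1) / 2))) :
    ManySubsums w E (k + 1) (min (q * (1 + 117 / p)) (((p : ℝ) ^ 3 + 1) / 2)) := by
  refine h.succ_of_exists fun U hUE hU Y hY => ?_
  have hp := (Fact.out : p.Prime).two_le
  have hp0 : (0 : ℝ) < p := by positivity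
  have hc := le_card_compl_union hn hE hU
  by_cases hYp : 2 * #Y ≤ p ^ 3
  · have hYp' : 2 * (#Y : ℝ) ≤ (p : ℝ) ^ 3 := by exact_mod_cast hYp
    have hqY : q ≤ #Y := (min_le_iff.1 hY).resolve_right (by linarith)
    obtain ⟨a, ha⟩ := card_pos.1 (show 0 < #(U ∪ E)ᶜ by omega)
    -- `8 * 312 * 4 = 9984` is just below the available `9992`, and `3 * 312 / 8 = 117`
    obtain ⟨b, hb, hab⟩ := exists_mul_card_le_mul_exitCard ⟨a, ha⟩ w (w a) (M := 4 * p) (s := 312)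
      (by norm_num) (fun ξ hξ t => (card_filter_compl_lt hw hξ t).le) (by omega) hYp
    have hab' : 117 * (#Y : ℝ) ≤ p * exitCard Y (w b - w a) := by
      have : 117 * #Y ≤ p * exitCard Y (w b - w a) := by
        rw [mul_assoc 8] at hab
        omega
      exact_mod_cast this
    refine ⟨a, mem_compl.1 ha, b, mem_compl.1 hb, ?_, (min_le_left _ _).trans ?_⟩
    · rintro rfl
      rw [sub_self, exitCard_zero] at hab'
      simp only [Nat.cast_zero, mul_zero] at hab'
      linarith
    · have h1 : 117 / (p : ℝ) * #Y ≤ exitCard Y (w b - w a) := by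
        rw [div_mul_eq_mul_div, div_le_iff₀ hp0]
        linarith
      have h2 : q * (1 + 117 / p) ≤ #Y * (1 + 117 / (p : ℝ)) := by gcongr
      linarith
  · have hodd3 : Odd (p ^ 3) := hodd.pow
    have hYp' : p ^ 3 + 1 ≤ 2 * #Y := by omega
    have hYp2 : (p : ℝ) ^ 3 + 1 ≤ 2 * #Y := by exact_mod_cast hYp'
    obtain ⟨a, ha, b, hb, hab⟩ := one_lt_card.1 (show 1 < #(U ∪ E)ᶜ by omega)
    refine ⟨a, mem_compl.1 ha, b, mem_compl.1 hb, hab, (min_le_right _ _).trans ?_⟩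
    have : (0 : ℝ) ≤ exitCard Y (w b - w a) := Nat.cast_nonneg _
    linarith

/-- A family spread over the affine planes has subsums of length `k` filling more than half of the
space: about `p / 4` pairs bring the set of sums to size `(p / 21) ^ 3`, and another `p / 9` pairs
suffice for thirteen doublings. -/
theorem manySubsums_half (hn : 9994 * p ≤ Fintype.card ι)
    (hw : ∀ ξ : Fin 3 → ZMod p, ξ ≠ 0 → ∀ t, #{i | ξ ⬝ᵥ w i = t} < 4 * p) (hp : 2000 ≤ p)
    (hodd : Odd p) (hE : #E + 2 * k ≤ 2 * p) (hk : p ≤ 2 * k + 1) :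
    ManySubsums w E k (((p : ℝ) ^ 3 + 1) / 2) := by
  have hp' : (2000 : ℝ) ≤ p := by exact_mod_cast hp
  have hp0 : (0 : ℝ) < p := by linarith
  have hgrow : ∀ j : ℕ, 4 * j + 20 ≤ p → ManySubsums w E j ((1 + (j : ℝ) / 5) ^ 3) := by
    intro j
    induction j with
    | zero => intro _; simpa using manySubsums_zero
    | succ j ih =>
      intro hj
      have hj' : 4 * ((j : ℝ) + 1) + 20 ≤ p := by exact_mod_cast hj
      have h := (ih (by omega)).succ_of_le_div hn hw (by omega)
        (le_add_of_nonneg_right (by positivity)) (by linarith)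
      convert h using 2
      push_cast
      ring
  set j := (p - 20) / 4 with hj
  have hstart : ManySubsums w E j (((p : ℝ) / 21) ^ 3) := by
    refine (hgrow j (by omega)).mono ?_
    have : p ≤ 4 * j + 23 := by omega
    have : (p : ℝ) ≤ 4 * j + 23 := by exact_mod_cast this
    gcongr
    linarith
  have hexp : ∀ l : ℕ, j + l ≤ k → ManySubsums w E (j + l)
      (min (((p : ℝ) / 21) ^ 3 * (1 + 117 / p) ^ l) (((p : ℝ) ^ 3 + 1) / 2)) := by
    intro l
    induction l with
    | zero => intro _; exact hstart.mono (by simp)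
    | succ l ih =>
      intro hl
      have h := (ih (by omega)).succ_min hn hw (by omega) hodd (by positivity)
      rwa [mul_assoc, ← pow_succ] at h
  set m := p / 117 + 1 with hm
  have hdouble : (2 : ℝ) ≤ (1 + 117 / p) ^ m := by
    have h1 := one_add_mul_le_pow (a := 117 / (p : ℝ)) (by
      have : (0 : ℝ) ≤ 117 / p := by positivity
      linarith) m
    have h2 : (1 : ℝ) ≤ m * (117 / p) := by
      rw [← mul_div_assoc, le_div_iff₀ hp0]
      have : p ≤ m * 117 := by omega
      rw [one_mul]
      exact_mod_cast this
    linarith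
  have hbig := (hexp (m * 13) (by omega)).mono (q' := ((p : ℝ) ^ 3 + 1) / 2) (by
    refine le_min ?_ le_rfl
    -- thirteen doublings suffice since `21 ^ 3 / 2 < 2 ^ 13`
    have h1 : (2 : ℝ) ^ 13 ≤ (1 + 117 / p) ^ (m * 13) := by
      rw [pow_mul]
      gcongr
    have h2 : (p : ℝ) ≤ (p : ℝ) ^ 3 := le_self_pow₀ (by linarith) three_ne_zero
    calc ((p : ℝ) ^ 3 + 1) / 2 ≤ ((p : ℝ) / 21) ^ 3 * 2 ^ 13 := by
          rw [div_pow]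
          norm_num1
          linarith
      _ ≤ _ := by gcongr)
  have hle : j + m * 13 ≤ k := by omega
  have := hbig.add hn (k - (j + m * 13)) (by omega)
  rwa [Nat.add_sub_cancel' hle] at this

/-- Two disjoint blocks of indices, of sizes `p - 1` and `p + 1`, have subsums of lengths
`(p - 1) / 2` and `(p + 1) / 2` filling more than half of the space, so some two of them cancel. -/
theorem exists_zeroSum_card_eq_of_spread (hn : 9994 * p ≤ Fintype.card ι)
    (hw : ∀ ξ : Fin 3 → ZMod p, ξ ≠ 0 → ∀ t, #{i | ξ ⬝ᵥ w i = t} < 4 * p) (hp : 2000 ≤ p)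
    (hodd : Odd p) : ∃ I : Finset ι, #I = p ∧ ∑ i ∈ I, w i = 0 := by
  obtain ⟨k, hk⟩ := hodd
  obtain ⟨U, Y, -, hU, hY, hYc⟩ := manySubsums_half (E := ∅) (k := k) hn hw hp ⟨k, hk⟩
    (by rw [card_empty]; omega) (by omega)
  obtain ⟨U', Y', hdisj, hU', hY', hYc'⟩ := manySubsums_half (E := U) (k := k + 1) hn hw hp ⟨k, hk⟩
    (by omega) (by omega)
  have hcard : p ^ 3 < #Y + #(Y'.image Neg.neg) := by
    rw [card_image_of_injective _ neg_injective]
    have : (p : ℝ) ^ 3 < #Y + #Y' := by linarith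
    exact_mod_cast this
  have hmeet : ¬ Disjoint Y (Y'.image Neg.neg) := by
    intro hd
    have h1 := card_le_univ (Y ∪ Y'.image Neg.neg)
    rw [card_union_of_disjoint hd, Fintype.card_fun, ZMod.card, Fintype.card_fin] at h1
    omega
  obtain ⟨y, hy, hy'⟩ := not_disjoint_iff.1 hmeet
  obtain ⟨z, hz, rfl⟩ := mem_image.1 hy'
  obtain ⟨I, hIU, hIc, hIs⟩ := hY _ hy
  obtain ⟨I', hIU', hIc', hIs'⟩ := hY' _ hz
  have hd : Disjoint I I' := (disjoint_of_subset_left hIU' (disjoint_of_subset_right hIU hdisj)).symm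
  refine ⟨I ∪ I', ?_, ?_⟩
  · rw [card_union_of_disjoint hd]
    omega
  · rw [sum_union hd, hIs, hIs', neg_add_cancel]


end Spread

/-- Vectors on a common affine plane: a zero-sum subfamily of size `p` in two suitable coordinates
is a zero-sum subfamily. -/
theorem exists_zeroSum_card_eq_of_plane {p : ℕ} [Fact p.Prime] (hp2 : p ≠ 2) {ι : Type*}
    [DecidableEq ι] [Fintype ι] {w : ι → Fin 3 → ZMod p} {ξ : Fin 3 → ZMod p} (hξ : ξ ≠ 0)
    {t : ZMod p} (h : 4 * p ≤ #{i | ξ ⬝ᵥ w i = t}) :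
    ∃ I : Finset ι, #I = p ∧ ∑ i ∈ I, w i = 0 := by
  obtain ⟨k, hk⟩ := Function.ne_iff.1 hξ
  obtain ⟨I, hI, hIc, hIs⟩ := exists_zeroSum_card_eq hp2 (fun i j => w i (k.succAbove j))
    (S := {i | ξ ⬝ᵥ w i = t}) (by omega)
  have hother : ∀ j, (∑ i ∈ I, w i) (k.succAbove j) = 0 := fun j => by
    have := congrFun hIs j
    rwa [Finset.sum_apply] at this ⊢
  have hsum : ξ ⬝ᵥ ∑ i ∈ I, w i = 0 := by
    rw [dotProduct_sum, sum_congr rfl fun i hi => (mem_filter.1 (hI hi)).2, sum_const, hIc,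
      nsmul_eq_mul, ZMod.natCast_self, zero_mul]
  rw [dotProduct, Fin.sum_univ_succAbove _ k] at hsum
  simp only [hother, mul_zero, sum_const_zero, add_zero] at hsum
  refine ⟨I, hIc, funext fun j => ?_⟩
  rcases Fin.eq_self_or_eq_succAbove k j with rfl | ⟨j, rfl⟩
  · exact (mul_eq_zero.1 hsum).resolve_left hk
  · exact hother j

theorem exists_zeroSum_card_eq_of_le_card {p : ℕ} [Fact p.Prime] {ι : Type*} [DecidableEq ι]
    [Fintype ι] (hn : 9994 * p ≤ Fintype.card ι) (w : ι → Fin 3 → ZMod p) :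
    ∃ I : Finset ι, #I = p ∧ ∑ i ∈ I, w i = 0 := by
  obtain rfl | hp2 := eq_or_ne p 2
  · -- two equal vectors
    obtain ⟨i, j, hij, hw⟩ := Fintype.exists_ne_map_eq_of_card_lt w (by
      rw [Fintype.card_fun, ZMod.card, Fintype.card_fin]
      omega)
    refine ⟨{i, j}, card_pair hij, ?_⟩
    rw [sum_pair hij, hw]
    exact CharTwo.add_self_eq_zero _
  by_cases hw : ∀ ξ : Fin 3 → ZMod p, ξ ≠ 0 → ∀ t, #{i | ξ ⬝ᵥ w i = t} < 4 * p
  · -- the planes with a given normal vector partition the family, so there are many of them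
    have hp : 2000 ≤ p := by
      have h1 : Fintype.card ι ≤ p * (4 * p) := by
        rw [← card_univ, card_eq_sum_card_fiberwise (f := fun i => (Pi.single 0 1) ⬝ᵥ w i)
          (t := (univ : Finset (ZMod p))) (fun _ _ => mem_univ _)]
        refine (sum_le_card_nsmul _ _ (4 * p) fun t _ => (hw _ (by simp) t).le).trans ?_
        rw [card_univ, ZMod.card, smul_eq_mul]
      have h2 := hn.trans h1
      have hp0 := (Fact.out : p.Prime).pos
      by_contra! h3
      nlinarith
    exact exists_zeroSum_card_eq_of_spread hn hw hp ((Fact.out : p.Prime).odd_of_ne_two hp2)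
  · push Not at hw
    obtain ⟨ξ, hξ, t, ht⟩ := hw
    exact exists_zeroSum_card_eq_of_plane hp2 hξ ht

theorem isAlonDubinerConstant_9994 : IsAlonDubinerConstant 9994 := by
  intro p _ n hn w
  refine exists_zeroSum_card_eq_of_le_card ?_ w
  rw [Fintype.card_fin]
  exact_mod_cast hn

/-! ### Primitive `p`-adic vectors -/

section Padic

variable {p : ℕ} [Fact p.Prime] {ι : Type*}

theorem PadicInt.toZMod_eq_zero_iff_dvd (x : ℤ_[p]) : PadicInt.toZMod x = 0 ↔ (p : ℤ_[p]) ∣ x := by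
  rw [← RingHom.mem_ker, PadicInt.ker_toZMod, PadicInt.maximalIdeal_eq_span_p,
    Ideal.mem_span_singleton]

theorem PadicInt.exists_eq_zmodRepr_add_mul (x : ℤ_[p]) :
    ∃ q : ℤ_[p], x = x.zmodRepr + p * q := by
  have h := PadicInt.sub_zmodRepr_mem x
  rw [PadicInt.maximalIdeal_eq_span_p, Ideal.mem_span_singleton] at h
  obtain ⟨q, hq⟩ := h
  exact ⟨q, by rw [← hq]; ring⟩

/-- The digits `zmodRepr` of at most `p` elements, not all zero, have a sum strictly between `0`
and `p ^ 2`. -/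
theorem not_sq_dvd_sum_of_dvd_sum {I : Finset ι} (hI : #I ≤ p) {x q : ι → ℤ_[p]}
    (hq : ∀ i, x i = (x i).zmodRepr + p * q i) (hne : ∃ i ∈ I, ¬ (p : ℤ_[p]) ∣ x i)
    (hdvd : (p : ℤ_[p]) ∣ ∑ i ∈ I, q i) : ¬ (p : ℤ_[p]) ^ 2 ∣ ∑ i ∈ I, x i := by
  intro h
  have hp := (Fact.out : p.Prime).pos
  have hsum : ∑ i ∈ I, x i = ((∑ i ∈ I, (x i).zmodRepr : ℕ) : ℤ_[p]) + p * ∑ i ∈ I, q i := by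
    rw [sum_congr rfl fun i _ => hq i, sum_add_distrib, mul_sum, Nat.cast_sum]
  have h1 : (p : ℤ_[p]) ^ 2 ∣ p * ∑ i ∈ I, q i := by
    rw [pow_two]
    exact mul_dvd_mul_left _ hdvd
  rw [hsum, dvd_add_left h1, ← Int.cast_natCast (∑ i ∈ I, (x i).zmodRepr),
    PadicInt.pow_p_dvd_int_iff] at h
  have h2 : p ^ 2 ∣ ∑ i ∈ I, (x i).zmodRepr := by exact_mod_cast h
  have h3 : 0 < ∑ i ∈ I, (x i).zmodRepr := by
    obtain ⟨i, hi, hd⟩ := hne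
    refine sum_pos' (fun _ _ => Nat.zero_le _) ⟨i, hi, Nat.pos_of_ne_zero ?_⟩
    rwa [Ne, PadicInt.zmodRepr_eq_zero_iff_dvd]
  have h4 : ∑ i ∈ I, (x i).zmodRepr ≤ #I * (p - 1) :=
    sum_le_card_nsmul _ _ _ fun i _ => Nat.le_sub_one_of_lt (PadicInt.zmodRepr_lt_p (x i))
  have h5 := Nat.le_of_dvd h3 h2
  have h6 := Nat.mul_le_mul_right (p - 1) hI
  have h7 : p * (p - 1) < p ^ 2 := by
    rw [pow_two]
    exact Nat.mul_lt_mul_of_pos_left (by omega) hp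
  omega

theorem dvd_sum_of_toZMod_sum_eq_zero {I : Finset ι} {x : ι → ℤ_[p]}
    (h : ∑ i ∈ I, PadicInt.toZMod (x i) = 0) : (p : ℤ_[p]) ∣ ∑ i ∈ I, x i := by
  rwa [← map_sum, PadicInt.toZMod_eq_zero_iff_dvd] at h

/-- Many vectors whose first entry is divisible by `p`: their second entries are units, and a short
zero-sum subfamily of the pairs (residue, next digit) of the second entries is as required. -/
theorem exists_short_sum_of_dvd_fst {v : ι → Fin 2 → ℤ_[p]} (hv : ∀ i, IsPrimitiveVec p (v i))
    {Z : Finset ι} (hZ : ∀ i ∈ Z, (p : ℤ_[p]) ∣ v i 0) (hc : 3 * p ≤ #Z + 2) :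
    ∃ I : Finset ι, 1 ≤ #I ∧ #I ≤ p ∧ (∀ j, (p : ℤ_[p]) ∣ (∑ i ∈ I, v i) j) ∧
      ∃ j, ¬ (p : ℤ_[p]) ^ 2 ∣ (∑ i ∈ I, v i) j := by
  classical
  choose q hq using fun i => PadicInt.exists_eq_zmodRepr_add_mul (v i 1)
  obtain ⟨I, hIZ, hne, hI, hs⟩ := exists_zeroSum_card_le
    (fun i => ![PadicInt.toZMod (v i 1), PadicInt.toZMod (q i)]) hc
  have hs0 := congrFun hs 0
  have hs1 := congrFun hs 1
  rw [Finset.sum_apply] at hs0 hs1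
  refine ⟨I, hne.card_pos, hI, fun j => ?_, 1, ?_⟩
  · rw [Finset.sum_apply]
    fin_cases j
    · exact dvd_sum fun i hi => hZ i (hIZ hi)
    · exact dvd_sum_of_toZMod_sum_eq_zero hs0
  · rw [Finset.sum_apply]
    refine not_sq_dvd_sum_of_dvd_sum hI hq ?_ (dvd_sum_of_toZMod_sum_eq_zero hs1)
    obtain ⟨i, hi⟩ := hne
    obtain ⟨j, hj⟩ := hv i
    refine ⟨i, hi, ?_⟩
    fin_cases j
    · exact absurd (hZ i (hIZ hi)) hj
    · exact hj

/-- Few vectors whose first entry is divisible by `p`: a zero-sum subfamily of size `p` of the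
triples (residues of both entries, next digit of the first entry) contains a vector whose first
entry is a unit. -/
theorem exists_short_sum_of_card_dvd_fst_lt {C₀ : ℝ} (hC : IsAlonDubinerConstant C₀)
    {v : ι → Fin 2 → ℤ_[p]} {J : Finset ι} (hJ : C₀ * p ≤ #J)
    (hlt : ∀ I ⊆ J, (∀ i ∈ I, (p : ℤ_[p]) ∣ v i 0) → #I < p) :
    ∃ I : Finset ι, 1 ≤ #I ∧ #I ≤ p ∧ (∀ j, (p : ℤ_[p]) ∣ (∑ i ∈ I, v i) j) ∧
      ∃ j, ¬ (p : ℤ_[p]) ^ 2 ∣ (∑ i ∈ I, v i) j := by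
  choose q hq using fun i => PadicInt.exists_eq_zmodRepr_add_mul (v i 0)
  let e : Fin #J ↪ ι := J.equivFin.symm.toEmbedding.trans (Function.Embedding.subtype _)
  obtain ⟨I', hc, hs⟩ := hC p #J hJ
    fun k => ![PadicInt.toZMod (v (e k) 0), PadicInt.toZMod (v (e k) 1), PadicInt.toZMod (q (e k))]
  have hsum : ∀ f : ι → ZMod p, ∑ i ∈ I'.map e, f i = ∑ k ∈ I', f (e k) := fun f => sum_map _ _ _
  have hs0 := congrFun hs 0
  have hs1 := congrFun hs 1
  have hs2 := congrFun hs 2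
  rw [Finset.sum_apply] at hs0 hs1 hs2
  have hIc : #(I'.map e) = p := by rw [card_map, hc]
  refine ⟨I'.map e, hIc.symm ▸ (Fact.out : p.Prime).one_le, hIc.le, fun j => ?_, 0, ?_⟩
  · rw [Finset.sum_apply]
    fin_cases j
    · exact dvd_sum_of_toZMod_sum_eq_zero ((hsum _).trans hs0)
    · exact dvd_sum_of_toZMod_sum_eq_zero ((hsum _).trans hs1)
  · rw [Finset.sum_apply]
    refine not_sq_dvd_sum_of_dvd_sum hIc.le hq ?_ (dvd_sum_of_toZMod_sum_eq_zero
      ((hsum _).trans hs2))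
    by_contra! hcon
    refine (hlt (I'.map e) ?_ hcon).ne hIc
    intro i hi
    obtain ⟨k, -, rfl⟩ := mem_map.1 hi
    exact (J.equivFin.symm k).2

/-- If fewer than `3 * p - 2` first entries are divisible by `p`, discarding at most `2 * p` of
these vectors leaves at most `p - 1` of them. -/
theorem exists_short_sum_of_isAlonDubinerConstant [Fintype ι] {C₀ : ℝ}
    (hC : IsAlonDubinerConstant C₀) (hn : (C₀ + 2) * p ≤ Fintype.card ι)
    {v : ι → Fin 2 → ℤ_[p]} (hv : ∀ i, IsPrimitiveVec p (v i)) :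
    ∃ I : Finset ι, 1 ≤ #I ∧ #I ≤ p ∧ (∀ j, (p : ℤ_[p]) ∣ (∑ i ∈ I, v i) j) ∧
      ∃ j, ¬ (p : ℤ_[p]) ^ 2 ∣ (∑ i ∈ I, v i) j := by
  classical
  have hp := (Fact.out : p.Prime).pos
  set Z : Finset ι := {i | (p : ℤ_[p]) ∣ v i 0} with hZ
  by_cases hc : 3 * p ≤ #Z + 2
  · exact exists_short_sum_of_dvd_fst hv (fun i hi => (mem_filter.1 hi).2) hc
  obtain ⟨D, hDZ, hD⟩ := exists_subset_card_eq (show #Z - (p - 1) ≤ #Z by omega)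
  refine exists_short_sum_of_card_dvd_fst_lt hC (J := Dᶜ) ?_ fun I hI hdvd => ?_
  · have h1 : Fintype.card ι ≤ #Dᶜ + 2 * p := by
      have := card_compl_add_card D
      omega
    have h2 : (Fintype.card ι : ℝ) ≤ #Dᶜ + 2 * p := by exact_mod_cast h1
    linarith
  · have h1 : I ⊆ Z \ D := fun i hi =>
      mem_sdiff.2 ⟨mem_filter.2 ⟨mem_univ i, hdvd i hi⟩, mem_compl.1 (hI hi)⟩
    have h2 := card_le_card h1
    rw [card_sdiff_of_subset hDZ] at h2
    omega

end Padic

theorem mainTheorem4 :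
    (∃ C₀ : ℝ, IsAlonDubinerConstant C₀ ∧ C₀ + 2 ≤ 9996) ∧
    (∀ C₀ C : ℝ, IsAlonDubinerConstant C₀ → C = C₀ + 2 →
      ∀ (p : ℕ) [Fact p.Prime] (n : ℕ), C * (p : ℝ) ≤ (n : ℝ) →
        ∀ v : Fin n → Fin 2 → ℤ_[p], (∀ i, IsPrimitiveVec p (v i)) →
          ∃ I : Finset (Fin n), 1 ≤ I.card ∧ I.card ≤ p ∧
            (∀ j, (p : ℤ_[p]) ∣ (∑ i ∈ I, v i) j) ∧
            (∃ j, ¬ (p : ℤ_[p]) ^ 2 ∣ (∑ i ∈ I, v i) j)) := by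
  refine ⟨⟨9994, isAlonDubinerConstant_9994, by norm_num⟩, ?_⟩
  rintro C₀ C hC rfl p _ n hn v hv
  exact exists_short_sum_of_isAlonDubinerConstant hC (by rwa [Fintype.card_fin]) hv
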